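/- Let $k$ be a field of characteristic $2$, let $n\ge 0$, and let $\Delta$ be a pseudo-manifold of dimension $n-1$ with (finite) vertex set $\{v_1,\dots,v_N\}$: a finite simplicial complex, with the empty set counted as a simplex of dimension $-1$, such that all maximal simplices have dimension $n-1$, every $(n-2)$-simplex lies in exactly two $(n-1)$-simplices, and any two $(n-1)$-simplices are joined by a chain of $(n-1)$-simplices in which consecutive ones share an $(n-2)$-simplex. Let $K=k(a_{i,j})$ be the field of rational functions in the variables $a_{i,j}$, $1\le i\le n$, $1\le j\le N$. For a maximal simplex $\sigma=\{v_{j_1},\dots,v_{j_n}\}$, with its vertices ordered arbitrarily, let $\det\sigma=\det(a_{i,j_l})_{i,l=1}^n\in K$, which is nonzero. For $f\in K[x_1,\dots,x_N]$ let $f_\sigma\in K[t_1,\dots,t_n]$ be obtained from $f$ by setting $x_j=0$ for $v_j\notin\sigma$ and then applying the inverse of the isomorphism $K[t_1,\dots,t_n]\to K[x_{j_1},\dots,x_{j_n}]$, $t_i\mapsto \sum_{l} a_{i,j_l}x_{j_l}$. Put $\chi_\sigma=\det\sigma\cdot (x_{j_1}\cdots x_{j_n})_\sigma$ and $$\pi_\Delta(f)=\sum_{\sigma\in\Delta_{n-1}}\frac{f_\sigma}{\chi_\sigma}\in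 K(t_1,\dots,t_n),$$ the sum being over all $(n-1)$-simplices of $\Delta$. Then $\pi_\Delta(f)\in K$ for every homogeneous $f$ of degree $n$, so that $\pi_\Delta$ restricts to a $K$-linear map $W_\Delta: K[x_1,\dots,x_N]_n\to K$ (the mixed volume). Moreover, for all vectors $I=(i_1,\dots,i_n)$ and $J=(j_1,\dots,j_n)$ with entries in $\{1,\dots,N\}$, with $x_I=x_{i_1}\cdots x_{i_n}$, $x_J=x_{j_1}\cdots x_{j_n}$ and $\partial_I=\partial_{a_{1,i_1}}\partial_{a_{2,i_2}}\cdots\partial_{a_{n,i_n}}$ acting on $K$, $$\partial_I W_\Delta(x_J)=\begin{cases}\big(W_\Delta(\sqrt{x_Ix_J})\big)^2 & \text{if } x_Ix_J \text{ is the square of a monomial } \sqrt{x_Ix_J},\\ 0 & \text{otherwise.}\end{cases}$$ -/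

import Mathlib

open scoped BigOperators

/-! ### Pseudo-manifolds -/

/-- The simplices of the complex `Δ`: its faces together with the empty simplex, which has
dimension `-1` (Mathlib's complexes do not list the empty face). -/
def IsSimplex {V : Type*} (Δ : AbstractSimplicialComplex V) (s : Finset V) : Prop :=
  s = ∅ ∨ s ∈ Δ.faces

open Classical in
/-- The finite set `Δ_{n-1}` of simplices of dimension `n - 1`, that is, with `n` vertices. -/
noncomputable def facets {V : Type*} [Fintype V] (Δ : AbstractSimplicialComplex V) (n : ℕ) :
    Finset (Finset V) :=
  Finset.univ.filter fun s => IsSimplex Δ s ∧ s.card = n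

theorem mem_facets {V : Type*} [Fintype V] {Δ : AbstractSimplicialComplex V} {n : ℕ}
    {s : Finset V} : s ∈ facets Δ n ↔ IsSimplex Δ s ∧ s.card = n := by
  classical
  simp [facets]

/-- Two `(n-1)`-simplices are adjacent if they share an `(n-2)`-simplex. -/
def FacetAdj {V : Type*} [Fintype V] (Δ : AbstractSimplicialComplex V) (n : ℕ)
    (σ σ' : Finset V) : Prop :=
  σ ∈ facets Δ n ∧ σ' ∈ facets Δ n ∧ ∃ τ : Finset V, τ.card + 1 = n ∧ τ ⊆ σ ∧ τ ⊆ σ'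

/-- `Δ` is a pseudo-manifold (without boundary) of dimension `n - 1`. -/
structure IsPseudoManifold {V : Type*} [Fintype V] (Δ : AbstractSimplicialComplex V) (n : ℕ) :
    Prop where
  /-- `Δ` is pure of dimension `n - 1`. -/
  pure : ∀ s : Finset V, Maximal (IsSimplex Δ) s → s.card = n
  /-- Every `(n-2)`-simplex lies in exactly two `(n-1)`-simplices. -/
  two_facets : ∀ τ : Finset V, IsSimplex Δ τ → τ.card + 1 = n →
    {σ : Finset V | σ ∈ facets Δ n ∧ τ ⊆ σ}.ncard = 2
  /-- `Δ` is strongly connected: the `(n-1)`-simplices are connected to each other through the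
  `(n-2)`-simplices. For `n ≥ 2` and `Δ` pure, this says that the geometric realization of `Δ`
  stays connected when the `(n-3)`-skeleton is removed. -/
  strongly_connected : ∀ σ ∈ facets Δ n, ∀ σ' ∈ facets Δ n,
    Relation.ReflTransGen (FacetAdj Δ n) σ σ'

/-! ### The field of rational functions and its partial derivatives -/

/-- The field `K = k(a_{i,j})` of rational functions, where `i` runs over the `n` linear
parameters and `j` over the vertices. -/
abbrev ParamField (k : Type*) [Field k] (n : ℕ) (V : Type*) : Type _ :=
  FractionRing (MvPolynomial (Fin n × V) k)

/-- The variable `a_{i,j}` as an element of `K`. -/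
noncomputable def paramVar (k : Type*) [Field k] {n : ℕ} {V : Type*} (i : Fin n) (j : V) :
    ParamField k n V :=
  algebraMap (MvPolynomial (Fin n × V) k) (ParamField k n V) (MvPolynomial.X (i, j))

/-- The quotient rule on the fraction field of a domain `A` with a derivation `D`. -/
noncomputable def quotientRule {k A : Type*} [CommRing k] [CommRing A] [IsDomain A] [Algebra k A]
    (D : Derivation k A A) (x : FractionRing A) : FractionRing A :=
  let a := (IsLocalization.sec (nonZeroDivisors A) x).1
  let b : A := (IsLocalization.sec (nonZeroDivisors A) x).2
  (algebraMap A (FractionRing A) (D a * b - a * D b)) / (algebraMap A (FractionRing A) b) ^ 2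

theorem quotientRule_div {k A : Type*} [CommRing k] [CommRing A] [IsDomain A] [Algebra k A]
    (D : Derivation k A A) (a b : A) (hb : b ≠ 0) :
    quotientRule D (algebraMap A (FractionRing A) a / algebraMap A (FractionRing A) b) =
      (algebraMap A (FractionRing A) (D a * b - a * D b)) /
        (algebraMap A (FractionRing A) b) ^ 2 := by
  have hinj := IsFractionRing.injective A (FractionRing A)
  have hb' : algebraMap A (FractionRing A) b ≠ 0 := by
    simpa using hinj.ne hb
  unfold quotientRule
  set x := algebraMap A (FractionRing A) a / algebraMap A (FractionRing A) b with hx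
  have hsec := IsLocalization.sec_spec (nonZeroDivisors A) x
  set c := (IsLocalization.sec (nonZeroDivisors A) x).1
  have hd := nonZeroDivisors.ne_zero (IsLocalization.sec (nonZeroDivisors A) x).2.2
  set d := (IsLocalization.sec (nonZeroDivisors A) x).2.1
  have hd' : algebraMap A (FractionRing A) d ≠ 0 := by
    simpa using hinj.ne hd
  have h1 : a * d = c * b := by
    apply hinj
    rw [map_mul, map_mul, ← hsec, hx]
    field_simp
  have h2 : a * D d + d * D a = c * D b + b * D c := by
    have := congrArg D h1
    simpa using this
  rw [div_eq_div_iff (pow_ne_zero 2 hd') (pow_ne_zero 2 hb')]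
  rw [← map_pow, ← map_pow, ← map_mul, ← map_mul]
  congr 1
  linear_combination (D b * d + D d * b) * h1 - b * d * h2

/-- The derivation of the fraction field that extends the derivation `D` of a domain. -/
noncomputable def fractionDerivation {k A : Type*} [CommRing k] [CommRing A] [IsDomain A]
    [Algebra k A] (D : Derivation k A A) : Derivation k (FractionRing A) (FractionRing A) where
  toFun := quotientRule D
  map_add' x y := by
    obtain ⟨a, b, hb, rfl⟩ := IsFractionRing.div_surjective (A := A) x
    obtain ⟨c, d, hd, rfl⟩ := IsFractionRing.div_surjective (A := A) y
    have hb0 := nonZeroDivisors.ne_zero hb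
    have hd0 := nonZeroDivisors.ne_zero hd
    have hinj := IsFractionRing.injective A (FractionRing A)
    have hb' : algebraMap A (FractionRing A) b ≠ 0 := by simpa using hinj.ne hb0
    have hd' : algebraMap A (FractionRing A) d ≠ 0 := by simpa using hinj.ne hd0
    rw [div_add_div _ _ hb' hd', ← map_mul, ← map_mul, ← map_mul, ← map_add,
      quotientRule_div D _ _ (mul_ne_zero hb0 hd0), quotientRule_div D _ _ hb0,
      quotientRule_div D _ _ hd0]
    simp only [map_add, map_sub, map_mul, Derivation.leibniz, smul_eq_mul]
    field_simp
    ring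
  map_smul' r x := by
    obtain ⟨a, b, hb, rfl⟩ := IsFractionRing.div_surjective (A := A) x
    have hb0 := nonZeroDivisors.ne_zero hb
    have h : r • (algebraMap A (FractionRing A) a / algebraMap A (FractionRing A) b) =
        algebraMap A (FractionRing A) (r • a) / algebraMap A (FractionRing A) b := by
      rw [Algebra.smul_def, Algebra.smul_def, map_mul, ← IsScalarTower.algebraMap_apply,
        mul_div_assoc]
    rw [h, quotientRule_div D _ _ hb0, quotientRule_div D _ _ hb0, RingHom.id_apply,
      Algebra.smul_def r (_ / _), IsScalarTower.algebraMap_apply k A (FractionRing A),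
      ← mul_div_assoc, ← map_mul, Derivation.map_smul, Algebra.smul_def, Algebra.smul_def]
    congr 2
    ring
  map_one_eq_zero' := by
    have h := quotientRule_div D 1 1 one_ne_zero
    simpa using h
  leibniz' x y := by
    obtain ⟨a, b, hb, rfl⟩ := IsFractionRing.div_surjective (A := A) x
    obtain ⟨c, d, hd, rfl⟩ := IsFractionRing.div_surjective (A := A) y
    have hb0 := nonZeroDivisors.ne_zero hb
    have hd0 := nonZeroDivisors.ne_zero hd
    have hinj := IsFractionRing.injective A (FractionRing A)
    have hb' : algebraMap A (FractionRing A) b ≠ 0 := by simpa using hinj.ne hb0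
    have hd' : algebraMap A (FractionRing A) d ≠ 0 := by simpa using hinj.ne hd0
    change quotientRule D _ = _ • quotientRule D _ + _ • quotientRule D _
    rw [div_mul_div_comm, ← map_mul, ← map_mul,
      quotientRule_div D _ _ (mul_ne_zero hb0 hd0), quotientRule_div D _ _ hb0,
      quotientRule_div D _ _ hd0]
    simp only [map_sub, map_add, map_mul, Derivation.leibniz, smul_eq_mul]
    field_simp
    ring

theorem fractionDerivation_algebraMap {k A : Type*} [CommRing k] [CommRing A] [IsDomain A]
    [Algebra k A] (D : Derivation k A A) (a : A) :
    fractionDerivation D (algebraMap A (FractionRing A) a) =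
      algebraMap A (FractionRing A) (D a) := by
  have h := quotientRule_div D a 1 one_ne_zero
  change quotientRule D _ = _
  simpa using h

/-- The partial derivative of `K = k(a_{i,j})` with respect to `a_{i,j}`. -/
noncomputable def paramDeriv (k : Type*) [Field k] {n : ℕ} {V : Type*} (i : Fin n) (j : V) :
    Derivation k (ParamField k n V) (ParamField k n V) :=
  fractionDerivation (MvPolynomial.pderiv (i, j))

/-- `∂_I = ∂_{a_{1,I_1}} ∘ ∂_{a_{2,I_2}} ∘ ⋯ ∘ ∂_{a_{n,I_n}}` on `K`. -/
noncomputable def multiDeriv (k : Type*) [Field k] {n : ℕ} {V : Type*} (I : Fin n → V) :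
    Module.End k (ParamField k n V) :=
  (List.ofFn fun i : Fin n =>
    ((paramDeriv k i (I i)).toLinearMap : Module.End k (ParamField k n V))).prod

/-! ### The integration map and the mixed volume -/

/-- The matrix whose determinant is `det σ`: its columns are the columns of `(a_{i,j})` that
belong to the vertices of `σ`, in the order `e`. -/
noncomputable def facetMatrix (k : Type*) [Field k] {n : ℕ} {V : Type*} {σ : Finset V}
    (e : Fin n ≃ {v // v ∈ σ}) : Matrix (Fin n) (Fin n) (ParamField k n V) :=
  Matrix.of fun i l => paramVar k i (e l : V)

theorem facetMatrix_det_ne_zero (k : Type*) [Field k] {n : ℕ} {V : Type*} {σ : Finset V}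
    (e : Fin n ≃ {v // v ∈ σ}) : (facetMatrix k e).det ≠ 0 := by
  let g : Fin n × Fin n → Fin n × V := fun p => (p.1, (e p.2 : V))
  have hg : Function.Injective g := by
    rintro ⟨i, l⟩ ⟨i', l'⟩ h
    simp only [g, Prod.mk.injEq] at h
    exact Prod.ext h.1 (e.injective (Subtype.ext h.2))
  let φ : MvPolynomial (Fin n × Fin n) k →+* ParamField k n V :=
    (algebraMap (MvPolynomial (Fin n × V) k) (ParamField k n V)).comp
      (MvPolynomial.rename g).toRingHom
  have hφ : Function.Injective φ :=
    (IsFractionRing.injective (MvPolynomial (Fin n × V) k) (ParamField k n V)).comp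
      (MvPolynomial.rename_injective g hg)
  have h : facetMatrix k e = φ.mapMatrix (Matrix.mvPolynomialX (Fin n) (Fin n) k) := by
    ext i l
    simp [facetMatrix, paramVar, φ, g, Matrix.mvPolynomialX]
  rw [h, ← RingHom.map_det]
  simpa using hφ.ne (Matrix.det_mvPolynomialX_ne_zero (Fin n) k)

/-- The variable `x_v` restricted to the maximal simplex `σ` and written in the coordinates
`t_1, …, t_n`, where `t_i = ∑_{v ∈ σ} a_{i,v} x_v` on `σ`. -/
noncomputable def facetCoord (k : Type*) [Field k] {n : ℕ} {V : Type*} [DecidableEq V]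
    {σ : Finset V} (e : Fin n ≃ {v // v ∈ σ}) (v : V) :
    MvPolynomial (Fin n) (ParamField k n V) :=
  if h : v ∈ σ then
    ∑ i : Fin n, MvPolynomial.C ((facetMatrix k e)⁻¹ (e.symm ⟨v, h⟩) i) * MvPolynomial.X i
  else 0

/-- The map `f ↦ f_σ` from `K[x_v]` to `K[t_1, …, t_n]`. -/
noncomputable def facetRestrict (k : Type*) [Field k] {n : ℕ} {V : Type*} [DecidableEq V]
    {σ : Finset V} (e : Fin n ≃ {v // v ∈ σ}) :
    MvPolynomial V (ParamField k n V) →ₐ[ParamField k n V]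
      MvPolynomial (Fin n) (ParamField k n V) :=
  MvPolynomial.aeval (facetCoord k e)

/-- The linear parameter `θ_i = ∑_j a_{i,j} x_j`. -/
noncomputable def linearParam (k : Type*) [Field k] {n : ℕ} {V : Type*} [Fintype V] (i : Fin n) :
    MvPolynomial V (ParamField k n V) :=
  ∑ j : V, MvPolynomial.C (paramVar k i j) * MvPolynomial.X j

/-- The map `f ↦ f_σ` is normalized by `θ_i ↦ t_i`. -/
theorem facetRestrict_linearParam (k : Type*) [Field k] {n : ℕ} {V : Type*} [Fintype V]
    [DecidableEq V] {σ : Finset V} (e : Fin n ≃ {v // v ∈ σ}) (i : Fin n) :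
    facetRestrict k e (linearParam k i) = MvPolynomial.X i := by
  have hM : facetMatrix k e * (facetMatrix k e)⁻¹ = 1 :=
    Matrix.mul_nonsing_inv _ (isUnit_iff_ne_zero.mpr (facetMatrix_det_ne_zero k e))
  have h1 : facetRestrict k e (linearParam k i) =
      ∑ j : V, MvPolynomial.C (paramVar k i j) * facetCoord k e j := by
    simp [facetRestrict, linearParam, MvPolynomial.algebraMap_eq]
  have h2 : ∑ j : V, MvPolynomial.C (paramVar k i j) * facetCoord k e j =
      ∑ j ∈ σ, MvPolynomial.C (paramVar k i j) * facetCoord k e j := by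
    symm
    apply Finset.sum_subset (Finset.subset_univ σ)
    intro j _ hj
    simp [facetCoord, hj]
  rw [h1, h2, ← Finset.sum_coe_sort, ← e.sum_comp]
  have h3 : ∀ l : Fin n, facetCoord k e (e l : V) =
      ∑ r : Fin n, MvPolynomial.C ((facetMatrix k e)⁻¹ l r) * MvPolynomial.X r := by
    intro l
    simp [facetCoord]
  simp_rw [h3, Finset.mul_sum]
  rw [Finset.sum_comm]
  have h4 : ∀ r : Fin n, ∑ l : Fin n, MvPolynomial.C (paramVar k i (e l : V)) *
      (MvPolynomial.C ((facetMatrix k e)⁻¹ l r) * MvPolynomial.X r) =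
      MvPolynomial.C ((1 : Matrix (Fin n) (Fin n) (ParamField k n V)) i r) *
        MvPolynomial.X r := by
    intro r
    rw [← hM, Matrix.mul_apply, map_sum, Finset.sum_mul]
    refine Finset.sum_congr rfl fun l _ => ?_
    rw [map_mul, mul_assoc]
    rfl
  simp_rw [h4, Matrix.one_apply]
  simp

/-- The polynomial `χ_σ = (det σ) x_{j_1} ⋯ x_{j_n}` in `K[t_1, …, t_n]`. -/
noncomputable def facetChi (k : Type*) [Field k] {n : ℕ} {V : Type*} [DecidableEq V]
    {σ : Finset V} (e : Fin n ≃ {v // v ∈ σ}) : MvPolynomial (Fin n) (ParamField k n V) :=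
  MvPolynomial.C (facetMatrix k e).det * ∏ v ∈ σ, facetCoord k e v

/-- An ordering of the vertices of each maximal simplex. In characteristic `2` every such choice
is an orientation of a pseudo-manifold. -/
abbrev FacetOrdering {V : Type*} [Fintype V] (Δ : AbstractSimplicialComplex V) (n : ℕ) : Type _ :=
  ∀ σ : {σ : Finset V // σ ∈ facets Δ n}, Fin n ≃ {v // v ∈ σ.1}

/-- The integration map `f ↦ ∑_σ f_σ / χ_σ` with values in `K(t_1, …, t_n)`, where `σ` runs over
the `(n-1)`-simplices of `Δ`. -/
noncomputable def integrationMap (k : Type*) [Field k] {n : ℕ} {V : Type*} [Fintype V]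
    [DecidableEq V] (Δ : AbstractSimplicialComplex V) (o : FacetOrdering Δ n) :
    MvPolynomial V (ParamField k n V) →ₗ[ParamField k n V]
      FractionRing (MvPolynomial (Fin n) (ParamField k n V)) :=
  ∑ σ : {σ : Finset V // σ ∈ facets Δ n},
    (LinearMap.mulRight (ParamField k n V)
        (algebraMap (MvPolynomial (Fin n) (ParamField k n V))
          (FractionRing (MvPolynomial (Fin n) (ParamField k n V))) (facetChi k (o σ)))⁻¹) ∘ₗ
      (IsScalarTower.toAlgHom (ParamField k n V) (MvPolynomial (Fin n) (ParamField k n V))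
        (FractionRing (MvPolynomial (Fin n) (ParamField k n V)))).toLinearMap ∘ₗ
      (facetRestrict k (o σ)).toLinearMap

theorem integrationMap_apply (k : Type*) [Field k] {n : ℕ} {V : Type*} [Fintype V]
    [DecidableEq V] (Δ : AbstractSimplicialComplex V) (o : FacetOrdering Δ n)
    (f : MvPolynomial V (ParamField k n V)) :
    integrationMap k Δ o f = ∑ σ : {σ : Finset V // σ ∈ facets Δ n},
      algebraMap (MvPolynomial (Fin n) (ParamField k n V))
          (FractionRing (MvPolynomial (Fin n) (ParamField k n V))) (facetRestrict k (o σ) f) /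
        algebraMap (MvPolynomial (Fin n) (ParamField k n V))
          (FractionRing (MvPolynomial (Fin n) (ParamField k n V))) (facetChi k (o σ)) := by
  simp [integrationMap, div_eq_mul_inv]

/-- `W` is the integration map in degree `n`, seen as a `K`-valued linear function: the integral
of every form `f` of degree `n` is the constant `W f`. -/
def IsMixedVolume {k : Type*} [Field k] {n : ℕ} {V : Type*} [Fintype V]
    [DecidableEq V] (Δ : AbstractSimplicialComplex V) (o : FacetOrdering Δ n)
    (W : MvPolynomial.homogeneousSubmodule V (ParamField k n V) n →ₗ[ParamField k n V]
      ParamField k n V) : Prop :=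
  ∀ f : MvPolynomial.homogeneousSubmodule V (ParamField k n V) n,
    integrationMap k Δ o (f : MvPolynomial V (ParamField k n V)) =
      algebraMap (ParamField k n V) (FractionRing (MvPolynomial (Fin n) (ParamField k n V))) (W f)

open Classical in
/-- The mixed volume `W_Δ : K[x_v]_n → K`. (The value `0` is taken if the integral of some form
of degree `n` is not a constant.) -/
noncomputable def mixedVolume (k : Type*) [Field k] {n : ℕ} {V : Type*} [Fintype V]
    [DecidableEq V] (Δ : AbstractSimplicialComplex V) (o : FacetOrdering Δ n) :
    MvPolynomial.homogeneousSubmodule V (ParamField k n V) n →ₗ[ParamField k n V]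
      ParamField k n V :=
  if h : ∃ W, IsMixedVolume (k := k) Δ o W then h.choose else 0

/-! ### Monomials -/

/-- The monomial `x_J = x_{J_1} ⋯ x_{J_n}` as a form of degree `n` over `K`. -/
noncomputable def monomialOf (k : Type*) [Field k] {n : ℕ} {V : Type*} (J : Fin n → V) :
    MvPolynomial.homogeneousSubmodule V (ParamField k n V) n :=
  ⟨∏ l : Fin n, MvPolynomial.X (J l), by
    rw [MvPolynomial.mem_homogeneousSubmodule]
    simpa using MvPolynomial.IsHomogeneous.prod (R := ParamField k n V) Finset.univ
      (fun l : Fin n => (MvPolynomial.X (J l) : MvPolynomial V (ParamField k n V)))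
      (fun _ => 1) (fun l _ => MvPolynomial.isHomogeneous_X _ (J l))⟩

/-- `M = √F`: `M` is a monomial whose square is `F`. -/
def IsMonomialSqrt {V R : Type*} [CommSemiring R] (M F : MvPolynomial V R) : Prop :=
  (∃ s : V →₀ ℕ, M = MvPolynomial.monomial s 1) ∧ M ^ 2 = F

/-!
Write `x_v|_σ` for the restriction of the variable `x_v` to a facet `σ`, a linear form in the `t_i`
whose coefficients are those of the inverse of the matrix of `σ`, and `0` if `v ∉ σ`.

*The integral of a form of degree `n` is a constant.* For a vertex `v` of a facet `σ` some
`K`-combination of the parameters `θ_i` has the shape `x_v + ∑_{w ∉ σ} c_w x_w`. Multiplication by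
it multiplies integrals by the nonzero linear form `x_v|_σ` (`facetVal_mul_integrationMap`). If `τ`
has `n - 1` vertices, then at most two facets contain it, and the coefficient `c_w` is the quotient
of their determinants by Cramer's rule, so that `x_τ` has integral `0`
(`integrationMap_prod_ridge`). From this, products of fewer than `n` distinct variables have
integral `0`. The same combination of the `θ_i` trades a repeated variable for variables outside
a facet (`integrationMap_monomial_mem`). Hence forms of degree less than `n` have integral `0`, and
the integral of a form of degree `n` is a combination of the constants `1 / det σ`.

*The derivatives.* Extend `∂/∂a_{i,w}` to `K(t_1, …, t_n)` with the `t_i` constant. As the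
vector of the `x_v|_σ` solves a linear system whose matrix is that of `σ` and whose right-hand side
is `t`, one finds `∂(x_v|_σ)/∂a_{i,w} = -x_w|_σ · ∂(x_v|_σ)/∂t_i`, and
`∂(det σ)/∂a_{i,w} = det σ · ∂(x_w|_σ)/∂t_i`. So for every `y` in `k(x_v|_σ : v ∈ σ)`
`∂(y / det σ)/∂a_{i,w} = -∂(x_w|_σ y / det σ)/∂t_i`
(`IsFacetFunction.columnDeriv_div_facetDet`). All these derivations commute, so in characteristic
two `∂_I` sends the contribution `x_J / χ_σ` of a facet to `∂/∂t_1 ⋯ ∂/∂t_n (x_I x_J / χ_σ)`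
(`columnOp_div_facetDet`). Squares are constants for derivations in characteristic two. If
`x_I x_J = M ^ 2`, what remains to be differentiated is the product of all `n` forms `x_v|_σ` with
`v ∈ σ`; the result is the permanent, which is the determinant, of the inverse matrix of `σ`, that
is, `1 / det σ`. If `x_I x_J` is not a square, there remain fewer than `n` linear forms and the
result is `0` (`columnOp_facetIntegral`). The sum over the facets is the claim, since squaring
is additive.
-/

/-! ### Derivations -/

namespace Derivation

variable {k A : Type*} [CommRing k] [CommRing A] [Algebra k A]

theorem map_prod_eq_zero {ι : Type*} (D : Derivation k A A) (s : Finset ι) (f : ι → A)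
    (h : ∀ i ∈ s, D (f i) = 0) : D (∏ i ∈ s, f i) = 0 := by
  classical
  induction s using Finset.induction_on with
  | empty => simp
  | insert a s ha ih =>
    rw [Finset.prod_insert ha, D.leibniz, h a (Finset.mem_insert_self a s),
      ih fun i hi => h i (Finset.mem_insert_of_mem hi)]
    simp

theorem map_det_eq_zero {m : Type*} [Fintype m] [DecidableEq m] (D : Derivation k A A)
    (M : Matrix m m A) (h : ∀ i j, D (M i j) = 0) : D M.det = 0 := by
  rw [Matrix.det_apply', map_sum]
  refine Finset.sum_eq_zero fun p _ => ?_
  rw [D.leibniz, D.map_intCast, D.map_prod_eq_zero _ _ fun i _ => h _ _]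
  simp

/-- The derivative of a determinant of which only the column `l` is not constant: in the Laplace
expansion along that column the cofactors are constant. -/
theorem map_det_of_col {m : Type*} [Fintype m] [DecidableEq m] (D : Derivation k A A)
    (M : Matrix m m A) (l : m) (h : ∀ i j, j ≠ l → D (M i j) = 0) :
    D M.det = ∑ i, M.adjugate l i * D (M i l) := by
  have hadj : ∀ i, D (M.adjugate l i) = 0 := by
    intro i
    have h1 : M.adjugate l i = (M.updateCol l (Pi.single i 1)).det := by
      rw [← Matrix.cramer_apply, Matrix.cramer_eq_adjugate_mulVec, Matrix.mulVec_single_one]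
      rfl
    rw [h1]
    refine D.map_det_eq_zero _ fun a b => ?_
    rw [Matrix.updateCol_apply]
    split_ifs with hb
    · rw [Pi.single_apply]
      split_ifs <;> simp
    · exact h a b hb
  rw [Matrix.det_eq_sum_mul_adjugate_col M l, map_sum]
  refine Finset.sum_congr rfl fun i _ => ?_
  rw [D.leibniz, hadj]
  simp

theorem ext_fractionRing [IsDomain A] {D D' : Derivation k (FractionRing A) (FractionRing A)}
    (h : ∀ a : A, D (algebraMap A _ a) = D' (algebraMap A _ a)) : D = D' := by
  ext x
  obtain ⟨a, b, -, rfl⟩ := IsFractionRing.div_surjective (A := A) x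
  rw [D.leibniz_div, D'.leibniz_div, h, h]

end Derivation

namespace MvPolynomial

variable {k R : Type*} [CommRing k] [CommRing R] [Algebra k R]

/-- Apply a derivation of `R` to the coefficients of a polynomial. -/
noncomputable def mapCoeffs {ι : Type*} (D : Derivation k R R) (p : MvPolynomial ι R) :
    MvPolynomial ι R :=
  ∑ s ∈ p.support, monomial s (D (p.coeff s))

theorem coeff_mapCoeffs {ι : Type*} (D : Derivation k R R) (p : MvPolynomial ι R) (m : ι →₀ ℕ) :
    coeff m (mapCoeffs D p) = D (coeff m p) := by
  classical
  simp only [mapCoeffs, coeff_sum, coeff_monomial]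
  rw [Finset.sum_ite_eq']
  split_ifs with hm
  · rfl
  · rw [notMem_support_iff.mp hm, D.map_zero]

/-- The derivation of `R[t_i]` that applies a derivation of `R` to the coefficients; the `t_i`
are constants for it. -/
noncomputable def coeffDerivation (ι : Type*) (D : Derivation k R R) :
    Derivation k (MvPolynomial ι R) (MvPolynomial ι R) :=
  Derivation.mk'
    { toFun := mapCoeffs D
      map_add' := fun p q => by
        ext m
        rw [coeff_add, coeff_mapCoeffs, coeff_mapCoeffs, coeff_mapCoeffs, coeff_add, D.map_add]
      map_smul' := fun r p => by
        ext m
        rw [RingHom.id_apply, coeff_smul, coeff_mapCoeffs, coeff_mapCoeffs, coeff_smul,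
          D.map_smul] }
    (by
      classical
      intro p q
      ext m
      change coeff m (mapCoeffs D (p * q)) = coeff m (p * mapCoeffs D q + q * mapCoeffs D p)
      rw [mul_comm q, coeff_add, coeff_mapCoeffs, coeff_mul, coeff_mul, coeff_mul, map_sum,
        ← Finset.sum_add_distrib]
      refine Finset.sum_congr rfl fun x _ => ?_
      rw [coeff_mapCoeffs, coeff_mapCoeffs, D.leibniz, smul_eq_mul, smul_eq_mul]
      ring)

theorem coeffDerivation_monomial {ι : Type*} (D : Derivation k R R) (s : ι →₀ ℕ) (c : R) :
    coeffDerivation ι D (monomial s c) = monomial s (D c) := by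
  classical
  ext m
  change coeff m (mapCoeffs D _) = _
  rw [coeff_mapCoeffs, coeff_monomial, coeff_monomial]
  split_ifs <;> simp

theorem coeffDerivation_C {ι : Type*} (D : Derivation k R R) (c : R) :
    coeffDerivation ι D (C c) = C (D c) :=
  coeffDerivation_monomial D 0 c

theorem coeffDerivation_X {ι : Type*} (D : Derivation k R R) (i : ι) :
    coeffDerivation ι D (X i) = 0 := by
  rw [X, coeffDerivation_monomial, D.map_one_eq_zero, map_zero]

theorem coeffDerivation_pderiv {ι : Type*} (D : Derivation k R R) (i : ι) (p : MvPolynomial ι R) :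
    coeffDerivation ι D (pderiv i p) = pderiv i (coeffDerivation ι D p) := by
  induction p using induction_on' with
  | monomial s c =>
    rw [pderiv_monomial, coeffDerivation_monomial, coeffDerivation_monomial, pderiv_monomial,
      D.leibniz, D.map_natCast, smul_zero, zero_add, smul_eq_mul, mul_comm]
  | add p q hp hq => simp only [map_add, hp, hq]

theorem pderiv_pderiv_comm {R ι : Type*} [CommRing R] (i j : ι) (p : MvPolynomial ι R) :
    pderiv i (pderiv j p) = pderiv j (pderiv i p) := by
  have h : ⁅pderiv (R := R) i, pderiv (R := R) j⁆ = 0 := by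
    classical
    refine derivation_ext fun l => ?_
    rw [Derivation.commutator_apply, pderiv_X, pderiv_X, Pi.single_apply, Pi.single_apply]
    split_ifs <;> simp
  have h1 := congrArg (fun D => D p) h
  rw [Derivation.commutator_apply] at h1
  exact sub_eq_zero.mp h1

end MvPolynomial

/-! ### The field `K(t_1, …, t_n)` and its partial derivatives -/

/-- The field `K(t_1, …, t_n)`. -/
abbrev IntegralField (k : Type*) [Field k] (n : ℕ) (V : Type*) : Type _ :=
  FractionRing (MvPolynomial (Fin n) (ParamField k n V))

section

variable (k : Type*) [Field k] {n : ℕ} {V : Type*}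

/-- The partial derivative of `K(t_1, …, t_n) = k(a_{i,j}, t_i)` with respect to `a_{i,w}`. -/
noncomputable def columnDeriv (i : Fin n) (w : V) :
    Derivation k (IntegralField k n V) (IntegralField k n V) :=
  fractionDerivation (MvPolynomial.coeffDerivation (Fin n) (paramDeriv k i w))

/-- The partial derivative of `K(t_1, …, t_n)` with respect to `t_i`. -/
noncomputable def coordDeriv (V : Type*) (i : Fin n) :
    Derivation (ParamField k n V) (IntegralField k n V) (IntegralField k n V) :=
  fractionDerivation (MvPolynomial.pderiv i)

/-- The variable `t_i` as an element of `K(t_1, …, t_n)`. -/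
noncomputable def coord (V : Type*) (i : Fin n) : IntegralField k n V :=
  algebraMap (MvPolynomial (Fin n) (ParamField k n V)) _ (MvPolynomial.X i)

variable {k}

theorem algebraMap_eq_C (c : ParamField k n V) :
    algebraMap (ParamField k n V) (IntegralField k n V) c =
      algebraMap (MvPolynomial (Fin n) (ParamField k n V)) _ (MvPolynomial.C c) := by
  rw [IsScalarTower.algebraMap_apply (ParamField k n V)
    (MvPolynomial (Fin n) (ParamField k n V)) (IntegralField k n V)]
  rfl

theorem columnDeriv_algebraMap (i : Fin n) (w : V) (c : ParamField k n V) :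
    columnDeriv k i w (algebraMap _ _ c) = algebraMap _ _ (paramDeriv k i w c) := by
  rw [algebraMap_eq_C, algebraMap_eq_C, columnDeriv, fractionDerivation_algebraMap,
    MvPolynomial.coeffDerivation_C]

theorem columnDeriv_coord (i : Fin n) (w : V) (j : Fin n) :
    columnDeriv k i w (coord k V j) = 0 := by
  rw [coord, columnDeriv, fractionDerivation_algebraMap, MvPolynomial.coeffDerivation_X, map_zero]

theorem coordDeriv_coord (i j : Fin n) :
    coordDeriv k V i (coord k V j) = if j = i then 1 else 0 := by
  classical
  rw [coord, coordDeriv, fractionDerivation_algebraMap, MvPolynomial.pderiv_X, Pi.single_apply]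
  split_ifs <;> simp

theorem paramDeriv_paramVar [DecidableEq V] (i : Fin n) (w : V) (j : Fin n) (v : V) :
    paramDeriv k i w (paramVar k j v) = if j = i ∧ v = w then 1 else 0 := by
  rw [paramVar, paramDeriv, fractionDerivation_algebraMap, MvPolynomial.pderiv_X, Pi.single_apply]
  simp only [Prod.mk.injEq]
  split_ifs <;> simp

theorem columnDeriv_coordDeriv (i : Fin n) (w : V) (j : Fin n) (x : IntegralField k n V) :
    columnDeriv k i w (coordDeriv k V j x) = coordDeriv k V j (columnDeriv k i w x) := by
  have h : ⁅columnDeriv k i w, (coordDeriv k V j).restrictScalars k⁆ = 0 := by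
    refine Derivation.ext_fractionRing fun a => ?_
    rw [Derivation.commutator_apply]
    simp only [Derivation.restrictScalars_apply, columnDeriv, coordDeriv,
      fractionDerivation_algebraMap, MvPolynomial.coeffDerivation_pderiv, sub_self,
      Derivation.zero_apply]
  have h1 := congrArg (fun D => D x) h
  rw [Derivation.commutator_apply] at h1
  exact sub_eq_zero.mp h1

theorem coordDeriv_comm (i j : Fin n) (x : IntegralField k n V) :
    coordDeriv k V i (coordDeriv k V j x) = coordDeriv k V j (coordDeriv k V i x) := by
  have h : ⁅coordDeriv k V i, coordDeriv k V j⁆ = 0 := by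
    refine Derivation.ext_fractionRing fun a => ?_
    rw [Derivation.commutator_apply]
    simp only [coordDeriv, fractionDerivation_algebraMap, MvPolynomial.pderiv_pderiv_comm i j,
      sub_self, Derivation.zero_apply]
  have h1 := congrArg (fun D => D x) h
  rw [Derivation.commutator_apply] at h1
  exact sub_eq_zero.mp h1

end

/-! ### The coordinates on one facet -/

section

variable (k : Type*) [Field k] {n : ℕ} {V : Type*} {σ : Finset V}

/-- The determinant `det σ` as an element of `K(t_1, …, t_n)`. -/
noncomputable def facetDet (e : Fin n ≃ {v // v ∈ σ}) : IntegralField k n V :=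
  algebraMap (ParamField k n V) _ (facetMatrix k e).det

variable {k}

theorem facetDet_ne_zero (e : Fin n ≃ {v // v ∈ σ}) : facetDet k e ≠ 0 := by
  rw [facetDet, map_ne_zero]
  exact facetMatrix_det_ne_zero k e

theorem facetMatrix_inv_mul (e : Fin n ≃ {v // v ∈ σ}) :
    (facetMatrix k e)⁻¹ * facetMatrix k e = 1 :=
  Matrix.nonsing_inv_mul _ (isUnit_iff_ne_zero.mpr (facetMatrix_det_ne_zero k e))

theorem facetMatrix_mul_inv (e : Fin n ≃ {v // v ∈ σ}) :
    facetMatrix k e * (facetMatrix k e)⁻¹ = 1 :=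
  Matrix.mul_nonsing_inv _ (isUnit_iff_ne_zero.mpr (facetMatrix_det_ne_zero k e))

variable [DecidableEq V]

variable (k) in
/-- The restriction of the variable `x_v` to the facet `σ`, as an element of `K(t_1, …, t_n)`.
By Cramer's rule it is a quotient of two determinants if `v ∈ σ`; otherwise it is `0`. -/
noncomputable def facetVal (e : Fin n ≃ {v // v ∈ σ}) (v : V) : IntegralField k n V :=
  algebraMap (MvPolynomial (Fin n) (ParamField k n V)) _ (facetCoord k e v)

theorem facetVal_of_notMem (e : Fin n ≃ {v // v ∈ σ}) {v : V} (hv : v ∉ σ) :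
    facetVal k e v = 0 := by
  rw [facetVal, facetCoord, dif_neg hv, map_zero]

theorem facetVal_vertex (e : Fin n ≃ {v // v ∈ σ}) (l : Fin n) :
    facetVal k e (e l) =
      ∑ i, algebraMap (ParamField k n V) _ ((facetMatrix k e)⁻¹ l i) * coord k V i := by
  rw [facetVal, facetCoord, dif_pos (e l).2, map_sum]
  refine Finset.sum_congr rfl fun i _ => ?_
  rw [map_mul, algebraMap_eq_C, coord]
  simp

theorem sum_paramVar_mul_facetVal (e : Fin n ≃ {v // v ∈ σ}) (j : Fin n) :
    ∑ l, algebraMap (ParamField k n V) _ (paramVar k j (e l : V)) * facetVal k e (e l) =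
      coord k V j := by
  simp_rw [facetVal_vertex, Finset.mul_sum]
  rw [Finset.sum_comm]
  have h : ∀ r : Fin n, ∑ l : Fin n, algebraMap (ParamField k n V) (IntegralField k n V)
      (paramVar k j (e l : V)) * (algebraMap (ParamField k n V) _ ((facetMatrix k e)⁻¹ l r) *
        coord k V r) =
      algebraMap (ParamField k n V) _ ((1 : Matrix (Fin n) (Fin n) (ParamField k n V)) j r) *
        coord k V r := by
    intro r
    rw [← facetMatrix_mul_inv e, Matrix.mul_apply, map_sum, Finset.sum_mul]
    refine Finset.sum_congr rfl fun l _ => ?_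
    rw [map_mul, mul_assoc]
    rfl
  simp_rw [h, Matrix.one_apply]
  simp

theorem facetVal_vertex_ne_zero (e : Fin n ≃ {v // v ∈ σ}) (l : Fin n) :
    facetVal k e (e l) ≠ 0 := by
  -- The row `l` of an invertible matrix does not vanish.
  intro h
  have hrow : ∀ i, (facetMatrix k e)⁻¹ l i = 0 := by
    intro i
    have h1 : facetCoord k e (e l : V) = 0 := by
      rw [facetVal] at h
      exact (IsFractionRing.injective (MvPolynomial (Fin n) (ParamField k n V))
        (IntegralField k n V)) (h.trans (map_zero _).symm)
    have h2 := congrArg (MvPolynomial.pderiv i) h1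
    classical
    simpa [facetCoord, MvPolynomial.pderiv_X, Pi.single_apply] using h2
  have h3 := congrFun (congrFun (facetMatrix_inv_mul (k := k) e) l) l
  rw [Matrix.mul_apply] at h3
  simp [hrow] at h3

theorem facetVal_ne_zero (e : Fin n ≃ {v // v ∈ σ}) {v : V} (hv : v ∈ σ) :
    facetVal k e v ≠ 0 := by
  simpa using facetVal_vertex_ne_zero (k := k) e (e.symm ⟨v, hv⟩)

theorem coordDeriv_facetVal (e : Fin n ≃ {v // v ∈ σ}) (i l : Fin n) :
    coordDeriv k V i (facetVal k e (e l)) =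
      algebraMap (ParamField k n V) _ ((facetMatrix k e)⁻¹ l i) := by
  rw [facetVal_vertex, map_sum]
  simp_rw [Derivation.leibniz, Derivation.map_algebraMap, coordDeriv_coord]
  simp

/-- A change of the column of `w` moves the coordinates on the facet just as a change of the
point `t` in the opposite direction, scaled by the coordinate of `w`. -/
theorem columnDeriv_facetVal (e : Fin n ≃ {v // v ∈ σ}) (i : Fin n) (w v : V) :
    columnDeriv k i w (facetVal k e v) = -(facetVal k e w * coordDeriv k V i (facetVal k e v)) := by
  by_cases hv : v ∈ σ
  swap
  · rw [facetVal_of_notMem e hv]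
    simp
  obtain ⟨l, rfl⟩ : ∃ l, v = e l := ⟨e.symm ⟨v, hv⟩, by simp⟩
  rw [coordDeriv_facetVal]
  have hw : ∀ j, ∑ l', (if j = i ∧ (e l' : V) = w then 1 else 0) * facetVal k e (e l') =
      if j = i then facetVal k e w else 0 := by
    intro j
    split_ifs with hj
    · by_cases hw : w ∈ σ
      · obtain ⟨m, rfl⟩ : ∃ m, w = e m := ⟨e.symm ⟨w, hw⟩, by simp⟩
        simp [hj]
      · rw [facetVal_of_notMem e hw]
        refine Finset.sum_eq_zero fun l' _ => ?_
        rw [if_neg, zero_mul]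
        rintro ⟨-, h⟩
        exact hw (h ▸ (e l').2)
    · simp [hj]
  have hD : ∀ j, ∑ l', algebraMap (ParamField k n V) _ (paramVar k j (e l' : V)) *
      columnDeriv k i w (facetVal k e (e l')) = -if j = i then facetVal k e w else 0 := by
    intro j
    have h := congrArg (columnDeriv k i w) (sum_paramVar_mul_facetVal e j)
    rw [columnDeriv_coord, map_sum] at h
    simp_rw [Derivation.leibniz, columnDeriv_algebraMap, paramDeriv_paramVar, smul_eq_mul] at h
    rw [Finset.sum_add_distrib] at h
    rw [← hw j, eq_neg_iff_add_eq_zero]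
    refine Eq.trans ?_ h
    congr 1
    refine Finset.sum_congr rfl fun l' _ => ?_
    split_ifs <;> simp
  have h1 : columnDeriv k i w (facetVal k e (e l)) =
      ∑ j, algebraMap (ParamField k n V) _ ((facetMatrix k e)⁻¹ l j) *
        ∑ l', algebraMap (ParamField k n V) _ (paramVar k j (e l' : V)) *
          columnDeriv k i w (facetVal k e (e l')) := by
    simp_rw [Finset.mul_sum]
    rw [Finset.sum_comm]
    have h : ∀ l', ∑ j, algebraMap (ParamField k n V) (IntegralField k n V)
        ((facetMatrix k e)⁻¹ l j) * (algebraMap (ParamField k n V) _ (paramVar k j (e l' : V)) *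
          columnDeriv k i w (facetVal k e (e l'))) =
        algebraMap (ParamField k n V) _ ((1 : Matrix (Fin n) (Fin n) (ParamField k n V)) l l') *
          columnDeriv k i w (facetVal k e (e l')) := by
      intro l'
      rw [← facetMatrix_inv_mul e, Matrix.mul_apply, map_sum, Finset.sum_mul]
      refine Finset.sum_congr rfl fun j _ => ?_
      rw [map_mul, mul_assoc]
      rfl
    simp_rw [h, Matrix.one_apply]
    simp
  rw [h1]
  simp_rw [hD]
  simp [mul_comm]

theorem columnDeriv_facetDet (e : Fin n ≃ {v // v ∈ σ}) (i : Fin n) (w : V) :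
    columnDeriv k i w (facetDet k e) =
      facetDet k e * coordDeriv k V i (facetVal k e w) := by
  rw [facetDet, columnDeriv_algebraMap]
  by_cases hw : w ∈ σ
  · obtain ⟨l, rfl⟩ : ∃ l, w = e l := ⟨e.symm ⟨w, hw⟩, by simp⟩
    rw [coordDeriv_facetVal, ← map_mul]
    congr 1
    rw [Derivation.map_det_of_col _ _ l]
    · simp only [facetMatrix, Matrix.of_apply, paramDeriv_paramVar]
      have hdet := facetMatrix_det_ne_zero k e
      have h : (facetMatrix k e)⁻¹ l i =
          (facetMatrix k e).det⁻¹ * (facetMatrix k e).adjugate l i := by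
        rw [Matrix.inv_def, Ring.inverse_eq_inv', Matrix.smul_apply, smul_eq_mul]
      change _ = (facetMatrix k e).det * (facetMatrix k e)⁻¹ l i
      rw [h, mul_inv_cancel_left₀ hdet]
      simp [facetMatrix]
    · intro a b hb
      rw [facetMatrix, Matrix.of_apply, paramDeriv_paramVar, if_neg]
      rintro ⟨-, h⟩
      exact hb (e.injective (Subtype.ext h))
  · rw [facetVal_of_notMem e hw, map_zero, mul_zero, Derivation.map_det_eq_zero, map_zero]
    intro a b
    rw [facetMatrix, Matrix.of_apply, paramDeriv_paramVar, if_neg]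
    rintro ⟨-, h⟩
    exact hw (h ▸ (e b).2)

/-- The elements on which `∂/∂a_{i,w}` acts as `-x_w ∂/∂t_i`, where `x_w` is restricted to the
facet. They include the coordinates on the facet. -/
def IsFacetFunction (e : Fin n ≃ {v // v ∈ σ}) (y : IntegralField k n V) : Prop :=
  ∀ i w, columnDeriv k i w y = -(facetVal k e w * coordDeriv k V i y)

namespace IsFacetFunction

variable {e : Fin n ≃ {v // v ∈ σ}}

theorem facetVal (v : V) : IsFacetFunction e (facetVal k e v) :=
  fun i w => columnDeriv_facetVal e i w v

theorem one : IsFacetFunction e (1 : IntegralField k n V) := fun i w => by simp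

theorem mul {x y : IntegralField k n V} (hx : IsFacetFunction e x) (hy : IsFacetFunction e y) :
    IsFacetFunction e (x * y) := by
  intro i w
  simp only [Derivation.leibniz, hx i w, hy i w, smul_eq_mul]
  ring

theorem inv {x : IntegralField k n V} (hx : IsFacetFunction e x) : IsFacetFunction e x⁻¹ := by
  intro i w
  simp only [Derivation.leibniz_inv, hx i w, smul_eq_mul]
  ring

theorem prod {ι : Type*} (s : Finset ι) {f : ι → IntegralField k n V}
    (h : ∀ i ∈ s, IsFacetFunction e (f i)) : IsFacetFunction e (∏ i ∈ s, f i) :=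
  Finset.prod_induction f (IsFacetFunction e) (fun _ _ => mul) one h

theorem columnDeriv_div_facetDet {y : IntegralField k n V} (hy : IsFacetFunction e y)
    (i : Fin n) (w : V) :
    columnDeriv k i w ((facetDet k e)⁻¹ * y) =
      -coordDeriv k V i ((facetDet k e)⁻¹ * (_root_.facetVal k e w * y)) := by
  have h0 : coordDeriv k V i (facetDet k e) = 0 := by
    rw [facetDet, Derivation.map_algebraMap]
  have hd := facetDet_ne_zero (k := k) e
  simp only [Derivation.leibniz, Derivation.leibniz_inv, hy i w, columnDeriv_facetDet, h0,
    smul_eq_mul]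
  field_simp
  ring

end IsFacetFunction

end

/-! ### Iterated partial derivatives -/

section

variable (k : Type*) [Field k] {n : ℕ} {V : Type*}

/-- The composition of the partial derivatives with respect to the `t_i`, for `i` in `L`. -/
noncomputable def coordOp (V : Type*) (L : List (Fin n)) :
    Module.End (ParamField k n V) (IntegralField k n V) :=
  (L.map fun i => (coordDeriv k V i).toLinearMap).prod

/-- The composition of the partial derivatives with respect to the `a_{i,I_i}`, for `i` in `L`. -/
noncomputable def columnOp (I : Fin n → V) (L : List (Fin n)) :
    Module.End k (IntegralField k n V) :=
  (L.map fun i => (columnDeriv k i (I i)).toLinearMap).prod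

variable {k}

theorem coordOp_cons (i : Fin n) (L : List (Fin n)) (x : IntegralField k n V) :
    coordOp k V (i :: L) x = coordDeriv k V i (coordOp k V L x) := by
  rw [coordOp, List.map_cons, List.prod_cons]
  rfl

theorem columnOp_cons (I : Fin n → V) (i : Fin n) (L : List (Fin n)) (x : IntegralField k n V) :
    columnOp k I (i :: L) x = columnDeriv k i (I i) (columnOp k I L x) := by
  rw [columnOp, List.map_cons, List.prod_cons]
  rfl

theorem coordOp_coordDeriv (L : List (Fin n)) (i : Fin n) (x : IntegralField k n V) :
    coordOp k V L (coordDeriv k V i x) = coordDeriv k V i (coordOp k V L x) := by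
  induction L with
  | nil => rfl
  | cons a L ih => rw [coordOp_cons, coordOp_cons, ih, coordDeriv_comm]

theorem columnDeriv_coordOp (i : Fin n) (w : V) (L : List (Fin n)) (x : IntegralField k n V) :
    columnDeriv k i w (coordOp k V L x) = coordOp k V L (columnDeriv k i w x) := by
  induction L with
  | nil => rfl
  | cons a L ih => rw [coordOp_cons, coordOp_cons, columnDeriv_coordDeriv, ih]

theorem algebraMap_multiDeriv (I : Fin n → V) (c : ParamField k n V) :
    algebraMap _ (IntegralField k n V) (multiDeriv k I c) =
      columnOp k I (List.finRange n) (algebraMap _ _ c) := by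
  have h : ∀ L : List (Fin n), algebraMap _ (IntegralField k n V)
      ((L.map fun i => ((paramDeriv k i (I i)).toLinearMap :
        Module.End k (ParamField k n V))).prod c) = columnOp k I L (algebraMap _ _ c) := by
    intro L
    induction L with
    | nil => rfl
    | cons a L ih =>
      rw [columnOp_cons, ← ih, columnDeriv_algebraMap, List.map_cons, List.prod_cons]
      rfl
  rw [← h, multiDeriv, List.ofFn_eq_map]

theorem coordOp_algebraMap_mul (L : List (Fin n)) (c : ParamField k n V)
    (x : IntegralField k n V) :
    coordOp k V L (algebraMap _ _ c * x) = algebraMap _ _ c * coordOp k V L x := by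
  rw [← Algebra.smul_def, map_smul, Algebra.smul_def]

theorem coordOp_eq_zero {L : List (Fin n)} {i : Fin n} (hi : i ∈ L) {x : IntegralField k n V}
    (hx : coordDeriv k V i x = 0) : coordOp k V L x = 0 := by
  induction L with
  | nil => simp at hi
  | cons a L ih =>
    rw [coordOp_cons]
    rcases List.mem_cons.mp hi with rfl | h
    · rw [← coordOp_coordDeriv, hx, map_zero]
    · rw [ih h, map_zero]

theorem coordOp_prod_coord_eq_zero {ι : Type*} [Fintype ι] {φ : ι → Fin n}
    (h : ¬ Function.Surjective φ) :
    coordOp k V (List.finRange n) (∏ l, coord k V (φ l)) = 0 := by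
  obtain ⟨i, hi⟩ := not_forall.mp h
  refine coordOp_eq_zero (List.mem_finRange i) (Derivation.map_prod_eq_zero _ _ _ fun l _ => ?_)
  rw [coordDeriv_coord, if_neg]
  exact fun h => hi ⟨l, h⟩

theorem coordOp_prod_coord :
    coordOp k V (List.finRange n) (∏ i, coord k V i) = 1 := by
  have h : ∀ L : List (Fin n), L.Nodup →
      coordOp k V L (L.map (coord k V)).prod = 1 := by
    intro L hL
    induction L with
    | nil => rfl
    | cons a L ih =>
      obtain ⟨ha, hL⟩ := List.nodup_cons.mp hL
      have h0 : coordDeriv k V a (L.map (coord k V)).prod = 0 := by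
        rw [← List.prod_toFinset _ hL]
        refine Derivation.map_prod_eq_zero _ _ _ fun i hi => ?_
        rw [coordDeriv_coord, if_neg]
        rintro rfl
        exact ha (List.mem_toFinset.mp hi)
      rw [coordOp_cons, ← coordOp_coordDeriv, List.map_cons, List.prod_cons, Derivation.leibniz,
        h0, coordDeriv_coord, if_pos rfl, smul_zero, zero_add, smul_eq_mul, mul_one, ih hL]
  rw [← h _ (List.nodup_finRange n), ← List.ofFn_eq_map, List.prod_ofFn]

theorem coordOp_prod_sum {ι : Type*} [Fintype ι] [DecidableEq ι]
    (c : ι → Fin n → ParamField k n V) :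
    coordOp k V (List.finRange n) (∏ l, ∑ i, algebraMap _ _ (c l i) * coord k V i) =
      ∑ φ : ι → Fin n, algebraMap _ _ (∏ l, c l (φ l)) *
        coordOp k V (List.finRange n) (∏ l, coord k V (φ l)) := by
  rw [Fintype.prod_sum, map_sum]
  refine Finset.sum_congr rfl fun φ _ => ?_
  rw [Finset.prod_mul_distrib, ← map_prod, coordOp_algebraMap_mul]

theorem coordOp_prod_linear_of_card_lt {ι : Type*} [Fintype ι] (h : Fintype.card ι < n)
    (c : ι → Fin n → ParamField k n V) :
    coordOp k V (List.finRange n) (∏ l, ∑ i, algebraMap _ _ (c l i) * coord k V i) = 0 := by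
  classical
  rw [coordOp_prod_sum]
  refine Finset.sum_eq_zero fun φ _ => ?_
  rw [coordOp_prod_coord_eq_zero, mul_zero]
  intro hφ
  have := Fintype.card_le_of_surjective φ hφ
  rw [Fintype.card_fin] at this
  omega

variable [CharP k 2]

instance ParamField.charTwo : CharP (ParamField k n V) 2 :=
  charP_of_injective_algebraMap (algebraMap k (ParamField k n V)).injective 2

instance IntegralField.charTwo : CharP (IntegralField k n V) 2 :=
  charP_of_injective_algebraMap (algebraMap (ParamField k n V) (IntegralField k n V)).injective 2

/-- The mixed partial derivative of a product of `n` linear forms is the permanent of their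
coefficients, which is the determinant in characteristic two. -/
theorem coordOp_prod_linear (c : Fin n → Fin n → ParamField k n V) :
    coordOp k V (List.finRange n) (∏ l, ∑ i, algebraMap _ _ (c l i) * coord k V i) =
      algebraMap _ _ (Matrix.of c).det := by
  rw [coordOp_prod_sum, ← Matrix.det_transpose, Matrix.det_apply', map_sum]
  symm
  refine Finset.sum_of_injOn (fun p : Equiv.Perm (Fin n) => (p : Fin n → Fin n))
    (fun p _ q _ h => DFunLike.coe_injective h) (fun p _ => Finset.mem_coe.mpr (Finset.mem_univ _))
    ?_ ?_
  · intro φ _ hφ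
    rw [coordOp_prod_coord_eq_zero, mul_zero]
    intro hs
    refine hφ ⟨Equiv.ofBijective φ (Finite.surjective_iff_bijective.mp hs), ?_, rfl⟩
    exact Finset.mem_coe.mpr (Finset.mem_univ _)
  · intro p _
    have h1 : ((Equiv.Perm.sign p : ℤˣ) : ℤ) = 1 ∨ ((Equiv.Perm.sign p : ℤˣ) : ℤ) = -1 := by
      rcases Int.units_eq_one_or (Equiv.Perm.sign p) with h | h <;> simp [h]
    have h2 : (((Equiv.Perm.sign p : ℤˣ) : ℤ) : ParamField k n V) = 1 := by
      rcases h1 with h | h <;> rw [h]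
      · simp
      · rw [Int.cast_neg, Int.cast_one, CharTwo.neg_eq]
    rw [h2, one_mul, Equiv.prod_comp p (coord k V), coordOp_prod_coord, mul_one]
    rfl

theorem coordOp_sq_mul (L : List (Fin n)) (q x : IntegralField k n V) :
    coordOp k V L (q ^ 2 * x) = q ^ 2 * coordOp k V L x := by
  induction L with
  | nil => rfl
  | cons a L ih =>
    have h : coordDeriv k V a (q ^ 2) = 0 := by
      rw [sq, Derivation.leibniz, CharTwo.add_self_eq_zero]
    rw [coordOp_cons, ih, Derivation.leibniz, h, smul_zero, add_zero, smul_eq_mul, coordOp_cons]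

end

/-! ### The derivatives of the contribution of one facet -/

section

variable {k : Type*} [Field k] {n : ℕ} {V : Type*} [DecidableEq V] {σ : Finset V}

/-- On the contributions of a facet, `∂_I` acts as multiplication by `x_I` followed by
`∂/∂t_1 ⋯ ∂/∂t_n`. -/
theorem columnOp_div_facetDet [CharP k 2] (e : Fin n ≃ {v // v ∈ σ}) (I : Fin n → V)
    (L : List (Fin n)) {y : IntegralField k n V} (hy : IsFacetFunction e y) :
    columnOp k I L ((facetDet k e)⁻¹ * y) =
      coordOp k V L ((facetDet k e)⁻¹ * ((L.map fun i => facetVal k e (I i)).prod * y)) := by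
  induction L with
  | nil => simp [columnOp, coordOp]
  | cons a L ih =>
    have hprod : ∀ L : List (Fin n),
        IsFacetFunction e (L.map fun i => facetVal k e (I i)).prod := by
      intro L
      induction L with
      | nil => exact IsFacetFunction.one
      | cons a L ih => exact (IsFacetFunction.facetVal _).mul ih
    rw [columnOp_cons, ih, columnDeriv_coordOp,
      IsFacetFunction.columnDeriv_div_facetDet ((hprod L).mul hy), CharTwo.neg_eq,
      coordOp_coordDeriv, coordOp_cons, List.map_cons, List.prod_cons, mul_assoc]

theorem facetVal_eq_sum (e : Fin n ≃ {v // v ∈ σ}) {v : V} (hv : v ∈ σ) :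
    facetVal k e v = ∑ i, algebraMap (ParamField k n V) _
      ((facetMatrix k e)⁻¹ (e.symm ⟨v, hv⟩) i) * coord k V i := by
  rw [← facetVal_vertex, Equiv.apply_symm_apply]

theorem coordOp_prod_facetVal [CharP k 2] (e : Fin n ≃ {v // v ∈ σ}) :
    coordOp k V (List.finRange n) (∏ v ∈ σ, facetVal k e v) = (facetDet k e)⁻¹ := by
  rw [← Finset.prod_coe_sort, ← e.prod_comp]
  simp_rw [facetVal_vertex]
  refine (coordOp_prod_linear fun l i => (facetMatrix k e)⁻¹ l i).trans ?_
  change algebraMap _ _ (facetMatrix k e)⁻¹.det = _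
  rw [Matrix.det_nonsing_inv, Ring.inverse_eq_inv', map_inv₀, facetDet]

theorem coordOp_prod_facetVal_of_ssubset (e : Fin n ≃ {v // v ∈ σ}) {S : Finset V} (hS : S ⊂ σ) :
    coordOp k V (List.finRange n) (∏ v ∈ S, facetVal k e v) = 0 := by
  have hcard : Fintype.card S < n := by
    have h1 := Finset.card_lt_card hS
    have h2 := Fintype.card_congr e
    rw [Fintype.card_fin, Fintype.card_coe] at h2
    rw [Fintype.card_coe]
    omega
  rw [← Finset.prod_coe_sort, ← coordOp_prod_linear_of_card_lt hcard
    fun l i => (facetMatrix k e)⁻¹ (e.symm ⟨l, hS.1 l.2⟩) i]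
  congr 1
  exact Finset.prod_congr rfl fun l _ => facetVal_eq_sum e (hS.1 l.2)

variable (k) in
/-- The contribution `f_σ / χ_σ` of a facet to the integration map. -/
noncomputable def facetIntegral (e : Fin n ≃ {v // v ∈ σ}) (f : MvPolynomial V (ParamField k n V)) :
    IntegralField k n V :=
  algebraMap (MvPolynomial (Fin n) (ParamField k n V)) _ (facetRestrict k e f) /
    algebraMap (MvPolynomial (Fin n) (ParamField k n V)) _ (facetChi k e)

theorem algebraMap_facetRestrict_X (e : Fin n ≃ {v // v ∈ σ}) (v : V) :
    algebraMap (MvPolynomial (Fin n) (ParamField k n V)) (IntegralField k n V)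
      (facetRestrict k e (MvPolynomial.X v)) = facetVal k e v := by
  rw [facetRestrict, MvPolynomial.aeval_X, facetVal]

theorem algebraMap_facetRestrict_prod_X {ι : Type*} (e : Fin n ≃ {v // v ∈ σ}) (s : Finset ι)
    (J : ι → V) :
    algebraMap (MvPolynomial (Fin n) (ParamField k n V)) (IntegralField k n V)
      (facetRestrict k e (∏ l ∈ s, MvPolynomial.X (J l))) = ∏ l ∈ s, facetVal k e (J l) := by
  rw [map_prod, map_prod]
  exact Finset.prod_congr rfl fun l _ => algebraMap_facetRestrict_X e (J l)

theorem algebraMap_facetChi (e : Fin n ≃ {v // v ∈ σ}) :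
    algebraMap (MvPolynomial (Fin n) (ParamField k n V)) (IntegralField k n V) (facetChi k e) =
      facetDet k e * ∏ v ∈ σ, facetVal k e v := by
  rw [facetChi, map_mul, ← algebraMap_eq_C, map_prod]
  rfl

/-- The contribution of one facet to the derivative of the mixed volume: with
`x_I x_J = N ^ 2 * ∏_{v ∈ O} x_v`, what is left of `x_I x_J / χ_σ` after splitting off a square is
the product of the coordinates of the vertices that are not in `O`. -/
theorem columnOp_facetIntegral [CharP k 2] (e : Fin n ≃ {v // v ∈ σ}) (I J : Fin n → V)
    (N : MvPolynomial V (ParamField k n V)) (O : Finset V)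
    (h : (monomialOf k I : MvPolynomial V (ParamField k n V)) *
      (monomialOf k J : MvPolynomial V (ParamField k n V)) =
      N ^ 2 * ∏ v ∈ O, MvPolynomial.X v) :
    columnOp k I (List.finRange n) (facetIntegral k e (monomialOf k J)) =
      if O = ∅ then facetIntegral k e N ^ 2 else 0 := by
  have hP : ∏ v ∈ σ, facetVal k e v ≠ 0 :=
    Finset.prod_ne_zero_iff.mpr fun v hv => facetVal_ne_zero e hv
  have h1 : facetIntegral k e (monomialOf k J) =
      (facetDet k e)⁻¹ * ((∏ l, facetVal k e (J l)) * (∏ v ∈ σ, facetVal k e v)⁻¹) := by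
    rw [facetIntegral, algebraMap_facetChi, monomialOf, algebraMap_facetRestrict_prod_X,
      div_eq_mul_inv, mul_inv]
    ring
  have hy : IsFacetFunction e ((∏ l, facetVal k e (J l)) * (∏ v ∈ σ, facetVal k e v)⁻¹) :=
    (IsFacetFunction.prod _ fun _ _ => IsFacetFunction.facetVal _).mul
      (IsFacetFunction.prod _ fun _ _ => IsFacetFunction.facetVal _).inv
  set ν : IntegralField k n V := algebraMap (MvPolynomial (Fin n) (ParamField k n V)) _
    (facetRestrict k e N) with hν
  have h2 : (∏ l, facetVal k e (I l)) * ∏ l, facetVal k e (J l) =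
      ν ^ 2 * ∏ v ∈ O, facetVal k e v := by
    have h3 := congrArg (fun f => algebraMap (MvPolynomial (Fin n) (ParamField k n V))
      (IntegralField k n V) (facetRestrict k e f)) h
    simp only [monomialOf, map_mul, map_pow] at h3
    rwa [algebraMap_facetRestrict_prod_X, algebraMap_facetRestrict_prod_X,
      algebraMap_facetRestrict_prod_X] at h3
  -- If `O ⊆ σ`, then `∏_O / ∏_σ = (∏_O / ∏_σ) ^ 2 * ∏_{σ \ O}`.
  rw [h1, columnOp_div_facetDet e I _ hy, ← List.ofFn_eq_map, List.prod_ofFn,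
    ← mul_assoc (∏ l, _), h2]
  by_cases hO : O ⊆ σ
  · have h4 : (facetDet k e)⁻¹ * (ν ^ 2 * (∏ v ∈ O, facetVal k e v) *
        (∏ v ∈ σ, facetVal k e v)⁻¹) =
        algebraMap (ParamField k n V) _ (facetMatrix k e).det⁻¹ *
          ((ν * (∏ v ∈ O, facetVal k e v) * (∏ v ∈ σ, facetVal k e v)⁻¹) ^ 2 *
            ∏ v ∈ σ \ O, facetVal k e v) := by
      rw [map_inv₀, ← facetDet]
      have h5 := Finset.prod_sdiff (f := facetVal k e) hO
      rw [← h5] at hP ⊢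
      have h6 := left_ne_zero_of_mul hP
      have h7 := right_ne_zero_of_mul hP
      field_simp
    rw [h4, coordOp_algebraMap_mul, coordOp_sq_mul]
    split_ifs with h0
    · subst h0
      rw [Finset.sdiff_empty, coordOp_prod_facetVal, map_inv₀, ← facetDet, facetIntegral,
        algebraMap_facetChi, ← hν, Finset.prod_empty]
      field_simp
    · rw [coordOp_prod_facetVal_of_ssubset e, mul_zero, mul_zero]
      exact Finset.sdiff_ssubset hO (Finset.nonempty_iff_ne_empty.mpr h0)
  · obtain ⟨v, hv, hvσ⟩ := Finset.not_subset.mp hO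
    rw [if_neg (Finset.ne_empty_of_mem hv), Finset.prod_eq_zero hv (facetVal_of_notMem e hvσ)]
    simp

/-- A monomial is the product of a square and of distinct variables. -/
theorem exists_eq_sq_mul_prod {R ι : Type*} [CommSemiring R] (s : Finset ι) (J : ι → V)
    (r : V →₀ ℕ) (O : Finset V) :
    ∃ (r' : V →₀ ℕ) (O' : Finset V),
      (MvPolynomial.monomial r (1 : R)) ^ 2 * (∏ v ∈ O, MvPolynomial.X v) *
        ∏ l ∈ s, MvPolynomial.X (J l) =
        (MvPolynomial.monomial r' 1) ^ 2 * ∏ v ∈ O', MvPolynomial.X v := by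
  classical
  induction s using Finset.induction_on generalizing r O with
  | empty => exact ⟨r, O, by simp⟩
  | insert a s ha ih =>
    rw [Finset.prod_insert ha]
    by_cases hO : J a ∈ O
    · obtain ⟨r', O', h⟩ := ih (r + Finsupp.single (J a) 1) (O.erase (J a))
      refine ⟨r', O', ?_⟩
      rw [← h, ← Finset.mul_prod_erase O _ hO, ← mul_one (1 : R), ← MvPolynomial.monomial_mul]
      simp only [MvPolynomial.X, mul_one]
      ring
    · obtain ⟨r', O', h⟩ := ih r (insert (J a) O)
      refine ⟨r', O', ?_⟩
      rw [← h, Finset.prod_insert hO]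
      ring

end

/-! ### The integration map in degree at most `n` -/

section

variable {k : Type*} [Field k] {n : ℕ} {V : Type*}

/-- In characteristic two a determinant does not depend on the order of its columns. -/
theorem det_paramVar_eq_of_range_eq [CharP k 2] {f g : Fin n → V} (hf : Function.Injective f)
    (hg : Function.Injective g) (h : Set.range f = Set.range g) :
    (Matrix.of fun i l : Fin n => paramVar k i (f l)).det =
      (Matrix.of fun i l : Fin n => paramVar k i (g l)).det := by
  let p : Equiv.Perm (Fin n) :=
    (Equiv.ofInjective f hf).trans ((Equiv.setCongr h).trans (Equiv.ofInjective g hg).symm)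
  have hp : ∀ l, g (p l) = f l := fun l => by
    have h1 := Equiv.apply_ofInjective_symm hg ⟨f l, h ▸ Set.mem_range_self l⟩
    exact h1
  have h1 : (Matrix.of fun i l : Fin n => paramVar k i (f l)) =
      (Matrix.of fun i l : Fin n => paramVar k i (g l)).submatrix id p := by
    ext i l
    simp [hp]
  rw [h1, Matrix.det_permute']
  rcases Int.units_eq_one_or (Equiv.Perm.sign p) with h2 | h2 <;> rw [h2]
  · simp
  · rw [Units.val_neg, Units.val_one, Int.cast_neg, Int.cast_one, CharTwo.neg_eq, one_mul]

variable {σ : Finset V}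

/-- The coefficient of `x_w` in the combination of the parameters `θ_i` that restricts to `x_v` on
the facet, where `v` is its vertex number `l`. -/
noncomputable def facetFormCoeff (k : Type*) [Field k] (e : Fin n ≃ {v // v ∈ σ}) (l : Fin n)
    (w : V) : ParamField k n V :=
  ∑ i, (facetMatrix k e)⁻¹ l i * paramVar k i w

theorem facetFormCoeff_vertex (e : Fin n ≃ {v // v ∈ σ}) (l m : Fin n) :
    facetFormCoeff k e l (e m) = if l = m then 1 else 0 := by
  rw [← Matrix.one_apply, ← facetMatrix_inv_mul e, Matrix.mul_apply]
  rfl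

/-- Cramer's rule: the coefficient of `x_w` is the quotient of the determinants of the two facets
that are exchanged by replacing the vertex number `l` by `w`. -/
theorem det_mul_facetFormCoeff [CharP k 2] {σ' : Finset V} (e : Fin n ≃ {v // v ∈ σ})
    (e' : Fin n ≃ {v // v ∈ σ'}) (l : Fin n) {w : V} (hw : w ∉ σ)
    (h : ∀ v, v ∈ σ' ↔ v = w ∨ v ∈ σ ∧ v ≠ e l) :
    (facetMatrix k e).det * facetFormCoeff k e l w = (facetMatrix k e').det := by
  have h1 : (facetMatrix k e).det * facetFormCoeff k e l w =
      Matrix.cramer (facetMatrix k e) (fun i => paramVar k i w) l := by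
    rw [Matrix.cramer_eq_adjugate_mulVec, facetFormCoeff, Finset.mul_sum, Matrix.mulVec,
      dotProduct]
    refine Finset.sum_congr rfl fun i _ => ?_
    rw [Matrix.inv_def, Ring.inverse_eq_inv', Matrix.smul_apply, smul_eq_mul, ← mul_assoc,
      mul_inv_cancel_left₀ (facetMatrix_det_ne_zero k e)]
  let f : Fin n → V := Function.update (fun m => (e m : V)) l w
  have h2 : (facetMatrix k e).updateCol l (fun i => paramVar k i w) =
      Matrix.of fun i m => paramVar k i (f m) := by
    ext i m
    rw [Matrix.updateCol_apply, Matrix.of_apply]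
    by_cases hm : m = l
    · simp [f, hm]
    · simp [f, hm, facetMatrix]
  rw [h1, Matrix.cramer_apply, h2]
  refine det_paramVar_eq_of_range_eq ?_ (Subtype.val_injective.comp e'.injective) ?_
  · intro a b hab
    by_cases ha : a = l <;> by_cases hb : b = l
    · rw [ha, hb]
    · simp only [f, ha, Function.update_self, Function.update_of_ne hb] at hab
      exact absurd (hab ▸ (e b).2) hw
    · simp only [f, hb, Function.update_self, Function.update_of_ne ha] at hab
      exact absurd (hab ▸ (e a).2) hw
    · simp only [f, Function.update_of_ne ha, Function.update_of_ne hb] at hab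
      exact e.injective (Subtype.ext hab)
  · ext v
    have h3 : v ∈ Set.range (fun m => (e' m : V)) ↔ v ∈ σ' :=
      ⟨fun ⟨m, hm⟩ => hm ▸ (e' m).2, fun hv => ⟨e'.symm ⟨v, hv⟩, by simp⟩⟩
    refine Iff.trans ?_ h3.symm
    rw [h v]
    constructor
    · rintro ⟨m, rfl⟩
      by_cases hm : m = l
      · left; simp [f, hm]
      · right
        simp only [f, Function.update_of_ne hm]
        exact ⟨(e m).2, fun h => hm (e.injective (Subtype.ext h))⟩
    · rintro (rfl | ⟨hv, hne⟩)
      · exact ⟨l, by simp [f]⟩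
      · refine ⟨e.symm ⟨v, hv⟩, ?_⟩
        have hne' : e.symm ⟨v, hv⟩ ≠ l := by
          rintro rfl
          simp at hne
        simp [f, Function.update_of_ne hne']

variable [Fintype V] [DecidableEq V]

theorem sum_inv_mul_linearParam (e : Fin n ≃ {v // v ∈ σ}) (l : Fin n) :
    ∑ i, MvPolynomial.C ((facetMatrix k e)⁻¹ l i) * linearParam k i =
      MvPolynomial.X (e l : V) +
        ∑ w ∈ σᶜ, MvPolynomial.C (facetFormCoeff k e l w) * MvPolynomial.X w := by
  have h : ∑ i, MvPolynomial.C ((facetMatrix k e)⁻¹ l i) * linearParam k i =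
      ∑ w, MvPolynomial.C (facetFormCoeff k e l w) * MvPolynomial.X w := by
    simp_rw [linearParam, Finset.mul_sum, facetFormCoeff, map_sum, Finset.sum_mul]
    rw [Finset.sum_comm]
    simp [mul_assoc]
  rw [h, ← Finset.sum_add_sum_compl σ]
  congr 1
  rw [← Finset.sum_coe_sort, ← e.sum_comp]
  simp [facetFormCoeff_vertex]

variable {Δ : AbstractSimplicialComplex V} (o : FacetOrdering Δ n)

theorem integrationMap_eq_sum_facetIntegral (f : MvPolynomial V (ParamField k n V)) :
    integrationMap k Δ o f =
      ∑ σ : {σ : Finset V // σ ∈ facets Δ n}, facetIntegral k (o σ) f :=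
  integrationMap_apply k Δ o f

theorem integrationMap_linearParam_mul (i : Fin n) (f : MvPolynomial V (ParamField k n V)) :
    integrationMap k Δ o (linearParam k i * f) = coord k V i * integrationMap k Δ o f := by
  rw [integrationMap_apply, integrationMap_apply, Finset.mul_sum]
  refine Finset.sum_congr rfl fun σ _ => ?_
  rw [map_mul, facetRestrict_linearParam, map_mul, mul_div_assoc]
  rfl

theorem integrationMap_C_mul (c : ParamField k n V) (f : MvPolynomial V (ParamField k n V)) :
    integrationMap k Δ o (MvPolynomial.C c * f) = c • integrationMap k Δ o f := by
  rw [← MvPolynomial.smul_eq_C_mul, map_smul]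

/-- Multiplying by the parameter that restricts to `x_v` on a facet containing `v` trades `x_v`
for variables outside the facet. -/
theorem facetVal_mul_integrationMap (e : Fin n ≃ {v // v ∈ σ}) (l : Fin n)
    (f : MvPolynomial V (ParamField k n V)) :
    facetVal k e (e l) * integrationMap k Δ o f =
      integrationMap k Δ o (MvPolynomial.X (e l : V) * f) +
        ∑ w ∈ σᶜ, facetFormCoeff k e l w • integrationMap k Δ o (MvPolynomial.X w * f) := by
  have h1 := congrArg (fun p => integrationMap k Δ o (p * f)) (sum_inv_mul_linearParam e l)
  simp only [Finset.sum_mul, add_mul, map_add, map_sum, mul_assoc, integrationMap_C_mul,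
    integrationMap_linearParam_mul] at h1
  rw [← h1, facetVal_vertex, Finset.sum_mul]
  simp_rw [Algebra.smul_def, mul_assoc]

theorem integrationMap_eq_zero_of_not_subset {s : Finset V} {f : MvPolynomial V (ParamField k n V)}
    (hf : ∀ v ∈ s, MvPolynomial.X v ∣ f) (hs : ∀ σ ∈ facets Δ n, ¬ s ⊆ σ) :
    integrationMap k Δ o f = 0 := by
  rw [integrationMap_eq_sum_facetIntegral]
  refine Finset.sum_eq_zero fun σ _ => ?_
  obtain ⟨v, hv, hvσ⟩ := Finset.not_subset.mp (hs σ.1 σ.2)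
  obtain ⟨g, rfl⟩ := hf v hv
  rw [facetIntegral, map_mul, map_mul, algebraMap_facetRestrict_X, facetVal_of_notMem _ hvσ,
    zero_mul, zero_div]

theorem integrationMap_prod_eq_zero {τ : Finset V} (hτ : ∀ σ ∈ facets Δ n, ¬ τ ⊆ σ) :
    integrationMap k Δ o (∏ v ∈ τ, MvPolynomial.X v) = 0 :=
  integrationMap_eq_zero_of_not_subset o (fun _ hv => Finset.dvd_prod_of_mem _ hv) hτ

theorem integrationMap_prod_facet (σ : {σ : Finset V // σ ∈ facets Δ n}) :
    integrationMap k Δ o (∏ v ∈ σ.1, MvPolynomial.X v) =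
      algebraMap _ _ (facetMatrix k (o σ)).det⁻¹ := by
  rw [integrationMap_eq_sum_facetIntegral, Finset.sum_eq_single σ]
  · have h : ∏ v ∈ σ.1, facetVal k (o σ) v ≠ 0 :=
      Finset.prod_ne_zero_iff.mpr fun v hv => facetVal_ne_zero _ hv
    have hd := facetDet_ne_zero (k := k) (o σ)
    rw [facetIntegral, algebraMap_facetChi, algebraMap_facetRestrict_prod_X, map_inv₀, ← facetDet]
    field_simp
  · intro σ' _ hne
    have hsub : ¬ σ.1 ⊆ σ'.1 := fun h => hne (Subtype.ext (Finset.eq_of_subset_of_card_le h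
      (by rw [(mem_facets.mp σ'.2).2, (mem_facets.mp σ.2).2])).symm)
    obtain ⟨v, hv, hvσ⟩ := Finset.not_subset.mp hsub
    rw [facetIntegral, algebraMap_facetRestrict_prod_X,
      Finset.prod_eq_zero hv (facetVal_of_notMem _ hvσ), zero_div]
  · exact fun h => absurd (Finset.mem_univ σ) h

theorem IsSimplex.subset {V : Type*} {Δ : AbstractSimplicialComplex V} {s t : Finset V}
    (hs : IsSimplex Δ s) (h : t ⊆ s) : IsSimplex Δ t := by
  rcases t.eq_empty_or_nonempty with ht | ht
  · exact Or.inl ht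
  · rcases hs with rfl | hs
    · exact absurd (Finset.subset_empty.mp h) ht.ne_empty
    · exact Or.inr ((Δ.isRelLowerSet_faces hs).2 h ht)

/-- The integral of a simplex of codimension one vanishes: the two facets that contain it have
equal contributions, and these cancel in characteristic two. -/
theorem integrationMap_prod_ridge [CharP k 2] (hΔ : IsPseudoManifold Δ n) {τ : Finset V}
    (hτ : τ.card + 1 = n) : integrationMap k Δ o (∏ v ∈ τ, MvPolynomial.X v) = 0 := by
  by_cases hex : ∃ σ ∈ facets Δ n, τ ⊆ σ
  swap
  · push Not at hex
    exact integrationMap_prod_eq_zero o hex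
  obtain ⟨σ₀, hσ₀, hτσ₀⟩ := hex
  have h2 := hΔ.two_facets τ ((mem_facets.mp hσ₀).1.subset hτσ₀) hτ
  obtain ⟨σ, σ', hne, hset⟩ := Set.ncard_eq_two.mp h2
  have hiff : ∀ ρ, (ρ ∈ facets Δ n ∧ τ ⊆ ρ) ↔ ρ = σ ∨ ρ = σ' := fun ρ => by
    have := Set.ext_iff.mp hset ρ
    simpa using this
  obtain ⟨hσ, hτσ⟩ := (hiff σ).mpr (Or.inl rfl)
  obtain ⟨hσ', hτσ'⟩ := (hiff σ').mpr (Or.inr rfl)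
  have hins : ∀ ρ ∈ facets Δ n, τ ⊆ ρ → ∃ v ∉ τ, insert v τ = ρ := fun ρ hρ hτρ =>
    (Finset.covBy_iff_exists_insert.mp (Finset.covBy_iff_card_sdiff_eq_one.mpr ⟨hτρ, by
      rw [Finset.card_sdiff_of_subset hτρ, (mem_facets.mp hρ).2]; omega⟩))
  obtain ⟨v, hv, rfl⟩ := hins σ hσ hτσ
  obtain ⟨w, hw, rfl⟩ := hins σ' hσ' hτσ'
  have hvw : w ≠ v := by
    rintro rfl
    exact hne rfl
  have hwσ : w ∉ insert v τ := by simp [hvw, hw]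
  set e := o ⟨_, hσ⟩ with he
  obtain ⟨l, hl⟩ : ∃ l, (e l : V) = v := ⟨e.symm ⟨v, Finset.mem_insert_self v τ⟩, by simp⟩
  have hmem : ∀ u, u ∈ insert w τ ↔ u = w ∨ u ∈ insert v τ ∧ u ≠ e l := by
    intro u
    rw [hl, Finset.mem_insert, Finset.mem_insert]
    constructor
    · rintro (h | h)
      · exact Or.inl h
      · exact Or.inr ⟨Or.inr h, fun huv => hv (huv ▸ h)⟩
    · rintro (h | ⟨h | h, huv⟩)
      · exact Or.inl h
      · exact absurd h huv
      · exact Or.inr h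
  have hdet := det_mul_facetFormCoeff (k := k) e (o ⟨_, hσ'⟩) l hwσ hmem
  have hc : facetFormCoeff k e l w ≠ 0 := by
    intro h0
    rw [h0, mul_zero] at hdet
    exact facetMatrix_det_ne_zero k _ hdet.symm
  -- Only the vertex `w` of the second facet contributes: no other one makes a facet with `τ`.
  have key := facetVal_mul_integrationMap (k := k) o e l (∏ v ∈ τ, MvPolynomial.X v)
  rw [Finset.sum_eq_single w, hl, ← Finset.prod_insert hv, ← Finset.prod_insert hw,
    integrationMap_prod_facet o ⟨_, hσ⟩, integrationMap_prod_facet o ⟨_, hσ'⟩, ← he,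
    Algebra.smul_def, ← map_mul, ← map_add, ← hdet] at key
  · have h3 : (facetMatrix k e).det⁻¹ + facetFormCoeff k e l w *
        ((facetMatrix k e).det * facetFormCoeff k e l w)⁻¹ = 0 := by
      rw [mul_inv, mul_left_comm, mul_inv_cancel₀ hc, mul_one, CharTwo.add_self_eq_zero]
    rw [h3, map_zero] at key
    exact (mul_eq_zero.mp key).resolve_left (facetVal_ne_zero e (Finset.mem_insert_self v τ))
  · intro u hu huw
    have huσ := Finset.mem_compl.mp hu
    have huτ : u ∉ τ := fun h => huσ (hτσ h)
    rw [← Finset.prod_insert huτ, integrationMap_prod_eq_zero o, smul_zero]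
    intro ρ hρ hsub
    have hu' : u ∈ ρ := hsub (Finset.mem_insert_self u τ)
    rcases (hiff ρ).mp ⟨hρ, (Finset.subset_insert u τ).trans hsub⟩ with rfl | rfl
    · exact huσ hu'
    · exact (Finset.mem_insert.mp hu').elim huw huτ
  · exact fun h => absurd (Finset.mem_compl.mpr hwσ) h

/-- The integral of a product of fewer than `n` distinct variables vanishes. By induction from
codimension one: its multiple by the nonzero form `x_v|_σ`, for a further vertex `v` of a facet `σ`,
is a combination of integrals of such products with one more variable. -/
theorem integrationMap_prod_of_card_lt [CharP k 2] (hΔ : IsPseudoManifold Δ n) (m : ℕ) :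
    ∀ τ : Finset V, τ.card + 1 + m = n →
      integrationMap k Δ o (∏ v ∈ τ, MvPolynomial.X v) = 0 := by
  induction m with
  | zero => exact fun τ hτ => integrationMap_prod_ridge o hΔ hτ
  | succ m ih =>
    intro τ hτ
    by_cases hex : ∃ σ ∈ facets Δ n, τ ⊆ σ
    swap
    · push Not at hex
      exact integrationMap_prod_eq_zero o hex
    obtain ⟨σ, hσ, hτσ⟩ := hex
    obtain ⟨v, hvσ, hvτ⟩ : ∃ v ∈ σ, v ∉ τ := by
      refine Finset.exists_mem_notMem_of_card_lt_card ?_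
      rw [(mem_facets.mp hσ).2]
      omega
    obtain ⟨l, rfl⟩ : ∃ l, ((o ⟨σ, hσ⟩) l : V) = v := ⟨(o ⟨σ, hσ⟩).symm ⟨v, hvσ⟩, by simp⟩
    have hins : ∀ w ∉ τ, integrationMap k Δ o
        (MvPolynomial.X w * ∏ v ∈ τ, MvPolynomial.X v) = 0 := by
      intro w hw
      rw [← Finset.prod_insert hw]
      refine ih _ ?_
      rw [Finset.card_insert_of_notMem hw]
      omega
    have key := facetVal_mul_integrationMap (k := k) o (o ⟨σ, hσ⟩) l (∏ v ∈ τ, MvPolynomial.X v)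
    rw [hins _ hvτ, zero_add, Finset.sum_eq_zero] at key
    · exact (mul_eq_zero.mp key).resolve_left (facetVal_vertex_ne_zero _ l)
    · intro w hw
      rw [hins w fun h => Finset.mem_compl.mp hw (hτσ h), smul_zero]

/-- Straightening: if the integral vanishes in degree `d - 1`, then its values in degree `d` are
combinations of its values on products of distinct variables. Indeed, a multiple vertex `v` of a
monomial is traded for vertices outside a facet, which enlarges the support. -/
theorem integrationMap_monomial_mem (d : ℕ)
    (T : Submodule (ParamField k n V) (IntegralField k n V))
    (h0 : ∀ s : V →₀ ℕ, s.degree + 1 = d → integrationMap k Δ o (MvPolynomial.monomial s 1) = 0)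
    (h1 : ∀ τ : Finset V, τ.card = d → integrationMap k Δ o (∏ v ∈ τ, MvPolynomial.X v) ∈ T)
    (c : ℕ) : ∀ s : V →₀ ℕ, s.degree = d → Fintype.card V ≤ s.support.card + c →
      integrationMap k Δ o (MvPolynomial.monomial s 1) ∈ T := by
  induction c using Nat.strong_induction_on with
  | _ c ih =>
    intro s hs hc
    by_cases hsq : ∀ v ∈ s.support, s v = 1
    · have h2 : MvPolynomial.monomial s (1 : ParamField k n V) =
          ∏ v ∈ s.support, MvPolynomial.X v := by
        rw [MvPolynomial.monomial_eq, map_one, one_mul, Finsupp.prod]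
        exact Finset.prod_congr rfl fun v hv => by rw [hsq v hv, pow_one]
      rw [h2]
      refine h1 _ ?_
      rw [← hs, Finsupp.degree_apply, Finset.sum_congr rfl hsq, Finset.card_eq_sum_ones]
    push Not at hsq
    obtain ⟨v, hv, hv1⟩ := hsq
    by_cases hex : ∃ σ ∈ facets Δ n, s.support ⊆ σ
    swap
    · push Not at hex
      rw [integrationMap_eq_zero_of_not_subset o (s := s.support) _ hex]
      · exact T.zero_mem
      · intro u hu
        exact MvPolynomial.X_dvd_monomial.mpr (Or.inr (Finsupp.mem_support_iff.mp hu))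
    obtain ⟨σ, hσ, hsσ⟩ := hex
    obtain ⟨l, rfl⟩ : ∃ l, ((o ⟨σ, hσ⟩) l : V) = v :=
      ⟨(o ⟨σ, hσ⟩).symm ⟨v, hsσ hv⟩, by simp⟩
    set v : V := ((o ⟨σ, hσ⟩) l : V)
    have hv2 : 2 ≤ s v := by
      have := Finsupp.mem_support_iff.mp hv
      omega
    obtain ⟨s', rfl⟩ : ∃ s', s = Finsupp.single v 1 + s' :=
      ⟨s - Finsupp.single v 1, by
        rw [add_tsub_cancel_of_le]
        rw [Finsupp.single_le_iff]
        omega⟩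
    have hX : ∀ w, MvPolynomial.X w * MvPolynomial.monomial s' (1 : ParamField k n V) =
        MvPolynomial.monomial (Finsupp.single w 1 + s') 1 := fun w => by
      rw [MvPolynomial.X, MvPolynomial.monomial_mul, one_mul]
    have key := facetVal_mul_integrationMap (k := k) o (o ⟨σ, hσ⟩) l (MvPolynomial.monomial s' 1)
    simp only [map_add, Finsupp.degree_single] at hs
    rw [h0 s' (by omega), mul_zero, hX] at key
    rw [eq_neg_of_add_eq_zero_left key.symm]
    refine T.neg_mem (T.sum_mem fun w hw => T.smul_mem _ ?_)
    rw [hX]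
    have hwσ := Finset.mem_compl.mp hw
    have hsupp : insert w (Finsupp.single v 1 + s').support ⊆
        (Finsupp.single w 1 + s').support := by
      intro u hu
      rw [Finsupp.mem_support_iff, Finsupp.add_apply]
      rcases Finset.mem_insert.mp hu with rfl | hu
      · simp
      · rw [Finsupp.mem_support_iff, Finsupp.add_apply] at hu
        rw [Finsupp.add_apply, Finsupp.single_eq_same] at hv2
        rcases eq_or_ne u v with huv | huv
        · rw [huv]
          omega
        · rw [Finsupp.single_eq_of_ne huv] at hu
          omega
    have hcard := Finset.card_le_card hsupp
    rw [Finset.card_insert_of_notMem fun h => hwσ (hsσ h)] at hcard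
    have hV := Finset.card_le_univ (Finsupp.single w 1 + s').support
    refine ih (c - 1) ?_ _ ?_ ?_
    · omega
    · simp only [map_add, Finsupp.degree_single]
      omega
    · omega

theorem integrationMap_monomial_of_degree_lt [CharP k 2] (hΔ : IsPseudoManifold Δ n) (d : ℕ) :
    d < n → ∀ s : V →₀ ℕ, s.degree = d →
      integrationMap k Δ o (MvPolynomial.monomial s 1) = 0 := by
  induction d with
  | zero =>
    intro hd s hs
    rw [← Submodule.mem_bot (ParamField k n V)]
    refine integrationMap_monomial_mem o 0 ⊥ (fun s h => absurd h (by omega)) (fun τ hτ => ?_) _ s hs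
      (Nat.le_add_left _ _)
    rw [Submodule.mem_bot]
    exact integrationMap_prod_of_card_lt o hΔ (n - 1) τ (by omega)
  | succ d ih =>
    intro hd s hs
    rw [← Submodule.mem_bot (ParamField k n V)]
    refine integrationMap_monomial_mem o (d + 1) ⊥ (fun s h => ih (by omega) s (by omega))
      (fun τ hτ => ?_) _ s hs (Nat.le_add_left _ _)
    rw [Submodule.mem_bot]
    exact integrationMap_prod_of_card_lt o hΔ (n - d - 2) τ (by omega)

theorem integrationMap_mem_range [CharP k 2] (hΔ : IsPseudoManifold Δ n)
    {f : MvPolynomial V (ParamField k n V)} (hf : f.IsHomogeneous n) :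
    integrationMap k Δ o f ∈
      LinearMap.range (Algebra.linearMap (ParamField k n V) (IntegralField k n V)) := by
  rw [f.as_sum, map_sum]
  refine Submodule.sum_mem _ fun s hs => ?_
  have hdeg : s.degree = n := by
    have h := hf (MvPolynomial.mem_support_iff.mp hs)
    rw [Finsupp.degree_eq_weight_one]
    exact h
  rw [← mul_one (MvPolynomial.coeff s f), ← smul_eq_mul, ← MvPolynomial.smul_monomial, map_smul]
  refine Submodule.smul_mem _ _ (integrationMap_monomial_mem o n _ (fun s h =>
    integrationMap_monomial_of_degree_lt o hΔ s.degree (by omega) s rfl) (fun τ hτ => ?_) _ s hdeg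
      (Nat.le_add_left _ _))
  by_cases hex : ∃ σ ∈ facets Δ n, τ ⊆ σ
  · obtain ⟨σ, hσ, hτσ⟩ := hex
    obtain rfl := Finset.eq_of_subset_of_card_le hτσ (by rw [hτ, (mem_facets.mp hσ).2])
    rw [integrationMap_prod_facet o ⟨τ, hσ⟩]
    exact ⟨_, rfl⟩
  · push Not at hex
    rw [integrationMap_prod_eq_zero o hex]
    exact Submodule.zero_mem _

/-! ### The mixed volume and its derivatives -/

theorem isMixedVolume_mixedVolume [CharP k 2] (hΔ : IsPseudoManifold Δ n) :
    IsMixedVolume Δ o (mixedVolume k Δ o) := by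
  have hex : ∃ W, IsMixedVolume (k := k) Δ o W := by
    have hinj : Function.Injective
        (Algebra.linearMap (ParamField k n V) (IntegralField k n V)) :=
      (algebraMap (ParamField k n V) (IntegralField k n V)).injective
    let π : MvPolynomial.homogeneousSubmodule V (ParamField k n V) n →ₗ[ParamField k n V]
        LinearMap.range (Algebra.linearMap (ParamField k n V) (IntegralField k n V)) :=
      ((integrationMap k Δ o).comp (Submodule.subtype _)).codRestrict _ fun f =>
        integrationMap_mem_range o hΔ ((MvPolynomial.mem_homogeneousSubmodule n _).mp f.2)
    refine ⟨(LinearEquiv.ofInjective _ hinj).symm.toLinearMap ∘ₗ π, fun f => ?_⟩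
    have h := LinearEquiv.apply_symm_apply (LinearEquiv.ofInjective _ hinj) (π f)
    exact (congrArg Subtype.val h).symm
  rw [mixedVolume, dif_pos hex]
  exact hex.choose_spec

/-- Squaring is additive in characteristic two, so the derivatives of the contributions of the
facets add up to the square of an integral. -/
theorem algebraMap_multiDeriv_mixedVolume [CharP k 2] (hΔ : IsPseudoManifold Δ n)
    (I J : Fin n → V) (N : MvPolynomial V (ParamField k n V)) (O : Finset V)
    (h : (monomialOf k I : MvPolynomial V (ParamField k n V)) *
      (monomialOf k J : MvPolynomial V (ParamField k n V)) =
      N ^ 2 * ∏ v ∈ O, MvPolynomial.X v) :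
    algebraMap _ (IntegralField k n V) (multiDeriv k I (mixedVolume k Δ o (monomialOf k J))) =
      if O = ∅ then integrationMap k Δ o N ^ 2 else 0 := by
  rw [algebraMap_multiDeriv, ← isMixedVolume_mixedVolume o hΔ,
    integrationMap_eq_sum_facetIntegral, map_sum]
  simp_rw [columnOp_facetIntegral _ I J N O h]
  split_ifs
  · rw [integrationMap_eq_sum_facetIntegral, CharTwo.sum_sq]
  · exact Finset.sum_const_zero

end

theorem mainTheorem1 {k : Type*} [Field k] [CharP k 2] {V : Type*} [Fintype V] [DecidableEq V]
    (n : ℕ) (Δ : AbstractSimplicialComplex V) (hΔ : IsPseudoManifold Δ n)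
    (o : FacetOrdering Δ n) :
    IsMixedVolume Δ o (mixedVolume k Δ o) ∧
    ∀ I J : Fin n → V,
      (∀ M : MvPolynomial.homogeneousSubmodule V (ParamField k n V) n,
        IsMonomialSqrt (M : MvPolynomial V (ParamField k n V))
          ((monomialOf k I : MvPolynomial V (ParamField k n V)) * monomialOf k J) →
        multiDeriv k I (mixedVolume k Δ o (monomialOf k J)) = (mixedVolume k Δ o M) ^ 2) ∧
      ((¬ ∃ M : MvPolynomial V (ParamField k n V),
        IsMonomialSqrt M
          ((monomialOf k I : MvPolynomial V (ParamField k n V)) * monomialOf k J)) →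
        multiDeriv k I (mixedVolume k Δ o (monomialOf k J)) = 0) := by
  have hinj := (algebraMap (ParamField k n V) (IntegralField k n V)).injective
  refine ⟨isMixedVolume_mixedVolume o hΔ, fun I J => ⟨fun M hM => ?_, fun hM => ?_⟩⟩
  · apply hinj
    rw [algebraMap_multiDeriv_mixedVolume o hΔ I J M ∅ (by simpa using hM.2.symm), if_pos rfl,
      map_pow, isMixedVolume_mixedVolume o hΔ M]
  · apply hinj
    obtain ⟨r, O, h1⟩ := exists_eq_sq_mul_prod (R := ParamField k n V) Finset.univ J 0 ∅
    obtain ⟨r', O', h2⟩ := exists_eq_sq_mul_prod (R := ParamField k n V) Finset.univ I r O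
    have h : (monomialOf k I : MvPolynomial V (ParamField k n V)) *
        (monomialOf k J : MvPolynomial V (ParamField k n V)) =
        (MvPolynomial.monomial r' 1) ^ 2 * ∏ v ∈ O', MvPolynomial.X v := by
      rw [← h2, ← h1]
      simp [monomialOf, mul_comm]
    have hO : O' ≠ ∅ := by
      rintro rfl
      exact hM ⟨_, ⟨r', rfl⟩, by simpa using h.symm⟩
    rw [algebraMap_multiDeriv_mixedVolume o hΔ I J _ O' h, if_neg hO, map_zero]
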